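/- Let $X$ be a finite set and let $X^*$ be the regular rooted tree whose vertices are the finite words over $X$, the root being the empty word and each word $p$ being joined by an edge to the words $px$, $x\in X$; the level $X^n$ consists of the words of length $n$. For $g\in\operatorname{Aut}X^*$ and $p\in X^*$, the state $g@p\in\operatorname{Aut}X^*$ is defined by $g(pq)=g(p)\,(g@p)(q)$, and $p*g\in\operatorname{Aut}X^*$ is the automorphism that sends $pq$ to $p\,g(q)$ and fixes all words without prefix $p$. Call an injective homomorphism $\rho\colon\Gamma\to\operatorname{Aut}X^*$ with image $G$ a level-transitive, self-similar, regular branch representation of the group $\Gamma$ if: $G$ acts transitively on every level $X^n$; $g@p\in G$ for all $g\in G$ and $p\in X^*$; and there is a subgroup $K\ne1$ of $G$ such that $p*K\le K$ for all $p\in X^*$ and such that the subgroup $X^n*K$ generated by all $p*K$ with $p\in X^n$ has finite index in $G$ for all $n\ge0$. Let $\widehat\Gamma$ be the profinite completion of $\Gamma$. Let $\overline\Gamma_\rho=\varprojlim_n\Gamma/\mathrm{Stab}_\Gamma(n)$ be its congruence completion, where $\mathrm{Stab}_\Gamma(n)$ consists of the elements of $\Gamma$ that act trivially, through $\rho$,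 on $X^n$. The congruence kernel of $\rho$ is the kernel of the natural map $\widehat\Gamma\to\overline\Gamma_\rho$. **Theorem.** Let $\Gamma$ be a group that has a level-transitive, self-similar, regular branch representation $\rho\colon\Gamma\to\operatorname{Aut}X^*$. Then 1. for every level-transitive, self-similar, regular branch representation $\sigma\colon\Gamma\to\operatorname{Aut}Y^*$ ($Y$ a finite set), the congruence kernels of $\sigma$ and of $\rho$ are the same subgroup of $\widehat\Gamma$; 2. the congruence kernel of $\rho$ is Abelian-by-(finite exponent): it has a closed normal Abelian subgroup such that the quotient has finite exponent. -/

import Mathlib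

universe u v w

namespace CongruenceKernel

section Tree

variable {X : Type v}

/-- The edges of the regular rooted tree `X^*`: vertices are the finite words over `X`, the root is
the empty word, and there is a directed edge from every word `p` to each one-letter extension
`p ++ [x]`. -/
def Edge (p q : List X) : Prop := ∃ x : X, q = p ++ [x]

/-- The automorphism group of the rooted tree `X^*`: the permutations of the vertices that preserve
the directed edges. -/
abbrev TreeAut (X : Type v) : Type v :=
  (Edge : List X → List X → Prop) ≃r (Edge : List X → List X → Prop)

theorem edge_append_left (p q r : List X) : Edge (p ++ q) (p ++ r) ↔ Edge q r := by
  simp [Edge, List.append_assoc]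

theorem TreeAut.apply_nil (g : TreeAut X) : g [] = [] := by
  rcases List.eq_nil_or_concat (g []) with h | ⟨p, x, h⟩
  · exact h
  · exfalso
    have h1 : Edge (g (g.symm p)) (g []) := ⟨x, by simpa using h⟩
    obtain ⟨y, hy⟩ := g.map_rel_iff.1 h1
    simp at hy

theorem TreeAut.exists_append (g : TreeAut X) (p q : List X) :
    ∃ r : List X, r.length = q.length ∧ g (p ++ q) = g p ++ r := by
  induction q using List.reverseRecOn with
  | nil => exact ⟨[], rfl, by simp⟩
  | append_singleton q x ih =>
    obtain ⟨r, hr, h⟩ := ih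
    have h1 : Edge (p ++ q) (p ++ (q ++ [x])) := ⟨x, by simp⟩
    obtain ⟨y, hy⟩ := g.map_rel_iff.2 h1
    exact ⟨r ++ [y], by simp [hr], by rw [hy, h, List.append_assoc]⟩

theorem TreeAut.length_apply (g : TreeAut X) (p : List X) : (g p).length = p.length := by
  obtain ⟨r, hr, h⟩ := g.exists_append [] p
  rw [List.nil_append, g.apply_nil, List.nil_append] at h
  rw [h, hr]

theorem TreeAut.apply_append (g : TreeAut X) (p q : List X) :
    g (p ++ q) = g p ++ (g (p ++ q)).drop p.length := by
  obtain ⟨r, -, h⟩ := g.exists_append p q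
  rw [h, ← g.length_apply p, List.drop_left]

/-- The state of `g` at the vertex `p`: the automorphism `g@p` of `X^*` with
`g (p ++ q) = g p ++ (g@p) q`. -/
def TreeAut.state (g : TreeAut X) (p : List X) : TreeAut X where
  toFun q := (g (p ++ q)).drop p.length
  invFun q := (g.symm (g p ++ q)).drop p.length
  left_inv q := by
    dsimp only
    rw [← g.apply_append, g.symm_apply_apply, List.drop_left]
  right_inv q := by
    have h := TreeAut.apply_append g.symm (g p) q
    rw [g.symm_apply_apply, g.length_apply] at h
    dsimp only
    rw [← h, g.apply_symm_apply, ← g.length_apply p, List.drop_left]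
  map_rel_iff' {q r} := by
    change Edge ((g (p ++ q)).drop p.length) ((g (p ++ r)).drop p.length) ↔ _
    rw [← edge_append_left (g p), ← g.apply_append, ← g.apply_append, g.map_rel_iff,
      edge_append_left]

open Classical in
/-- The action of `p*g` on words: `p ++ q` is sent to `p ++ g q`, and words that do not have `p` as
a prefix are fixed. -/
noncomputable def translateFun (p : List X) (g : TreeAut X) (q : List X) : List X :=
  if p <+: q then p ++ g (q.drop p.length) else q

theorem translateFun_append (p : List X) (g : TreeAut X) (q : List X) :
    translateFun p g (p ++ q) = p ++ g q := by
  simp [translateFun]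

theorem translateFun_of_not {p q : List X} (g : TreeAut X) (h : ¬ p <+: q) :
    translateFun p g q = q := by
  simp [translateFun, h]

theorem translateFun_mul (p : List X) (g h : TreeAut X) (q : List X) :
    translateFun p (g * h) q = translateFun p g (translateFun p h q) := by
  by_cases hq : p <+: q
  · obtain ⟨r, rfl⟩ := hq
    simp [translateFun_append]
  · simp [translateFun_of_not _ hq]

theorem translateFun_one (p q : List X) : translateFun p 1 q = q := by
  by_cases hq : p <+: q
  · obtain ⟨r, rfl⟩ := hq
    simp [translateFun_append]
  · simp [translateFun_of_not _ hq]

theorem edge_translateFun (p : List X) (g : TreeAut X) {q r : List X} (h : Edge q r) :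
    Edge (translateFun p g q) (translateFun p g r) := by
  by_cases hq : p <+: q
  · obtain ⟨x, rfl⟩ := h
    obtain ⟨s, rfl⟩ := hq
    rw [List.append_assoc, translateFun_append, translateFun_append, edge_append_left,
      g.map_rel_iff]
    exact ⟨x, rfl⟩
  · rw [translateFun_of_not _ hq]
    by_cases hr : p <+: r
    · obtain ⟨x, rfl⟩ := h
      have hp : p = q ++ [x] := (List.prefix_concat_iff.1 hr).resolve_right hq
      have h2 := translateFun_append p g []
      rw [List.append_nil, g.apply_nil, List.append_nil] at h2
      rw [← hp, h2]
      exact ⟨x, hp⟩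
    · rwa [translateFun_of_not _ hr]

/-- The homomorphism `g ↦ p*g`, where `p*g` acts as `g` on the subtree rooted at `p` and fixes every
vertex outside of that subtree. -/
noncomputable def translate (p : List X) : TreeAut X →* TreeAut X where
  toFun g :=
    { toFun := translateFun p g
      invFun := translateFun p g⁻¹
      left_inv := fun q => by rw [← translateFun_mul, inv_mul_cancel, translateFun_one]
      right_inv := fun q => by rw [← translateFun_mul, mul_inv_cancel, translateFun_one]
      map_rel_iff' := fun {q r} => by
        refine ⟨fun h => ?_, edge_translateFun p g⟩
        have h1 := edge_translateFun p g⁻¹ h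
        simpa [← translateFun_mul, translateFun_one] using h1 }
  map_one' := RelIso.ext fun q => translateFun_one p q
  map_mul' g h := RelIso.ext fun q => translateFun_mul p g h q

/-- `G` acts transitively on every level `X^n` of the tree. -/
def LevelTransitive (G : Subgroup (TreeAut X)) : Prop :=
  ∀ p q : List X, p.length = q.length → ∃ g ∈ G, g p = q

/-- `G` is self-similar: all states of elements of `G` belong to `G`. -/
def SelfSimilar (G : Subgroup (TreeAut X)) : Prop :=
  ∀ g ∈ G, ∀ p : List X, g.state p ∈ G

/-- `X^n * K`, the subgroup generated by the `p*K` for all vertices `p` of level `n`. -/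
noncomputable def levelTranslate (n : ℕ) (K : Subgroup (TreeAut X)) : Subgroup (TreeAut X) :=
  ⨆ p : {p : List X // p.length = n}, K.map (translate p.1)

/-- `G` is regular branch: it has a non-trivial subgroup `K` with `p*K ≤ K` for all vertices `p`,
such that `X^n * K` has finite index in `G` for all `n`. -/
def RegularBranch (G : Subgroup (TreeAut X)) : Prop :=
  ∃ K : Subgroup (TreeAut X), K ≤ G ∧ K ≠ ⊥ ∧ (∀ p : List X, K.map (translate p) ≤ K) ∧
    ∀ n : ℕ, (levelTranslate n K).IsFiniteRelIndex G

end Tree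

section Representation

variable {Γ : Type u} [Group Γ] {X : Type v}

/-- A representation of `Γ` on the tree `X^*` that is faithful, level-transitive, self-similar and
regular branch. -/
structure IsRegularBranchRep (ρ : Γ →* TreeAut X) : Prop where
  faithful : Function.Injective ρ
  levelTransitive : LevelTransitive ρ.range
  selfSimilar : SelfSimilar ρ.range
  regularBranch : RegularBranch ρ.range

/-- The action of the tree automorphisms on the level `X^n`. -/
def levelAction (X : Type v) (n : ℕ) :
    TreeAut X →* Equiv.Perm {p : List X // p.length = n} where
  toFun g := g.toEquiv.subtypeEquiv fun p => by
    change _ ↔ (g p).length = n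
    rw [g.length_apply]
  map_one' := rfl
  map_mul' _ _ := rfl

/-- The level stabilizer `stab_Γ(n)`: the elements of `Γ` that fix all vertices of level `n`. -/
def levelStab (ρ : Γ →* TreeAut X) (n : ℕ) : Subgroup Γ :=
  ((levelAction X n).comp ρ).ker

instance levelStab_normal (ρ : Γ →* TreeAut X) (n : ℕ) : (levelStab ρ n).Normal :=
  MonoidHom.normal_ker _

theorem mem_levelStab (ρ : Γ →* TreeAut X) (n : ℕ) (g : Γ) :
    g ∈ levelStab ρ n ↔ ∀ p : List X, p.length = n → ρ g p = p := by
  rw [levelStab, MonoidHom.mem_ker, Equiv.ext_iff]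
  simp only [Subtype.forall, Subtype.ext_iff]
  rfl

theorem levelStab_succ_le (ρ : Γ →* TreeAut X) (n : ℕ) :
    levelStab ρ (n + 1) ≤ levelStab ρ n := by
  intro g hg
  rw [mem_levelStab] at hg ⊢
  intro p hp
  rcases isEmpty_or_nonempty X with hX | ⟨⟨x⟩⟩
  · exact Subsingleton.elim _ _
  · have h1 := hg (p ++ [x]) (by simp [hp])
    obtain ⟨r, hr, h⟩ := (ρ g).exists_append p [x]
    rw [h1] at h
    exact (List.append_inj h ((ρ g).length_apply p).symm).1.symm

instance levelStab_finiteIndex [Finite X] (ρ : Γ →* TreeAut X) (n : ℕ) :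
    (levelStab ρ n).FiniteIndex := by
  cases nonempty_fintype X
  have : Finite {p : List X // p.length = n} := inferInstanceAs (Finite (List.Vector X n))
  exact Subgroup.finiteIndex_ker _

/-- The congruence completion of `Γ`, that is its completion with respect to the level stabilizers:
the inverse limit of the quotients of `Γ` by the `stab_Γ(n)`. -/
def CongruenceCompletion (ρ : Γ →* TreeAut X) : Subgroup (∀ n : ℕ, Γ ⧸ levelStab ρ n) where
  carrier := {x | ∀ n : ℕ, QuotientGroup.map (levelStab ρ (n + 1)) (levelStab ρ n)
    (MonoidHom.id Γ) (levelStab_succ_le ρ n) (x (n + 1)) = x n}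
  one_mem' n := map_one _
  mul_mem' {x y} hx hy n := by
    rw [Pi.mul_apply, map_mul, hx n, hy n, Pi.mul_apply]
  inv_mem' {x} hx n := by
    rw [Pi.inv_apply, map_inv, hx n, Pi.inv_apply]

/-- The profinite completion of `Γ`. -/
abbrev ProfiniteCompletion (Γ : Type u) [Group Γ] : Type u :=
  ProfiniteGrp.ProfiniteCompletion.completion (GrpCat.of Γ)

/-- The projection of the profinite completion of `Γ` onto the quotient of `Γ` by a normal subgroup
of finite index. -/
def toQuotient (N : FiniteIndexNormalSubgroup Γ) : ProfiniteCompletion Γ →* Γ ⧸ N.toSubgroup where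
  toFun x := x.1 N
  map_one' := rfl
  map_mul' _ _ := rfl

theorem map_toQuotient {M N : FiniteIndexNormalSubgroup Γ} (h : M.toSubgroup ≤ N.toSubgroup)
    (x : ProfiniteCompletion Γ) :
    QuotientGroup.map M.toSubgroup N.toSubgroup (MonoidHom.id Γ) h (toQuotient M x) =
      toQuotient N x :=
  x.2 (CategoryTheory.homOfLE (show M ≤ N from h))

/-- The natural map from the profinite completion to the congruence completion. -/
def toCongruenceCompletion [Finite X] (ρ : Γ →* TreeAut X) :
    ProfiniteCompletion Γ →* CongruenceCompletion ρ :=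
  MonoidHom.codRestrict
    (MonoidHom.pi fun n : ℕ => toQuotient (FiniteIndexNormalSubgroup.ofSubgroup (levelStab ρ n)))
    (CongruenceCompletion ρ)
    fun x n => map_toQuotient (M := FiniteIndexNormalSubgroup.ofSubgroup (levelStab ρ (n + 1)))
      (N := FiniteIndexNormalSubgroup.ofSubgroup (levelStab ρ n)) (levelStab_succ_le ρ n) x

/-- The congruence kernel of a representation: the kernel of the natural map from the profinite
completion to the congruence completion. -/
def congruenceKernel [Finite X] (ρ : Γ →* TreeAut X) : Subgroup (ProfiniteCompletion Γ) :=
  (toCongruenceCompletion ρ).ker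

end Representation

/-- A topological group `C` is abelian-by-(finite exponent): it has a closed normal abelian subgroup
`A` such that the quotient of `C` by `A` has finite exponent. -/
def AbelianByFiniteExponent (C : Type u) [Group C] [TopologicalSpace C] : Prop :=
  ∃ (A : Subgroup C) (_ : A.Normal), IsClosed (A : Set C) ∧
    (∀ a ∈ A, ∀ b ∈ A, a * b = b * a) ∧ Monoid.ExponentExists (C ⧸ A)

end CongruenceKernel

/-!
The proof rests on the rigid stabilizers `rist ρ p` of the vertices `p` and on one commutator
identity, `commutator_mem_of_moves`: if a subgroup `H` contains an element that moves `p`, then it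
contains every commutator of elements of `rist ρ p` that normalize `H`.

Independence of the congruence kernel. Let `ρ` and `σ` be regular branch representations, `v` a
vertex of the tree of `ρ`, and `w` a vertex of the tree of `σ` that is moved by some element of
`rist ρ v`. The commutator identity shows that `rist ρ v` contains the derived subgroup of
`rist σ w ∩ levelStab ρ n`, where `n` is the level of `v`. This derived subgroup is non-trivial,
because rigid stabilizers in a regular branch group are not virtually abelian, whereas rigid
stabilizers of distinct vertices of the same level meet trivially. So `w` determines `v` among the
vertices of its level, and, by equivariance, an element of `Γ` that fixes `w` also fixes `v`. By
level-transitivity this holds for every `v` of level `n`, with `w` on a fixed level, so that every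
level stabilizer of `ρ` contains one of `σ` (`exists_levelStab_le`).

Structure of the congruence kernel. The rigid level stabilizers `ristLevel ρ n` are normal and have
finite index, and the kernel of the map to the completion that they define is the closed
normal subgroup `branchKernel`. By the commutator identity with `H` normal, each finite-index normal
subgroup contains the derived subgroup of some `ristLevel ρ n`, and hence the branch kernel is
abelian (`branchKernel_commute`). Finally, an element `g` of the stabilizer of the level `n` is the
product of the `p*(g@p)` with `p` of level `n`, and each state `g@p` is in the image of `ρ`, in
which the branching subgroup `K` has finite index. A fixed power of all these states therefore lies
in `K`, and the same power of `g` lies in `X^n*K`, hence in `ristLevel ρ n`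
(`exists_pow_mem_ristLevel`). So this power maps the congruence kernel into the branch kernel.
-/

namespace CongruenceKernel

/-! ### States and translates -/

section TreeLemmas

variable {X : Type v}

theorem TreeAut.mul_apply (g h : TreeAut X) (q : List X) : (g * h) q = g (h q) := rfl

theorem TreeAut.inv_apply_self (g : TreeAut X) (q : List X) : g⁻¹ (g q) = q := g.symm_apply_apply q

theorem TreeAut.apply_inv_self (g : TreeAut X) (q : List X) : g (g⁻¹ q) = q := g.apply_symm_apply q

theorem translate_apply (p : List X) (g : TreeAut X) (q : List X) :
    translate p g q = translateFun p g q := rfl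

theorem TreeAut.apply_append_state (g : TreeAut X) (p q : List X) :
    g (p ++ q) = g p ++ g.state p q := g.apply_append p q

theorem TreeAut.prefix_apply (g : TreeAut X) {p q : List X} (h : p <+: q) : g p <+: g q := by
  obtain ⟨r, rfl⟩ := h
  rw [g.apply_append_state]
  exact List.prefix_append _ _

theorem TreeAut.prefix_apply_iff (g : TreeAut X) {p q : List X} : g p <+: g q ↔ p <+: q := by
  refine ⟨fun h => ?_, g.prefix_apply⟩
  simpa only [TreeAut.inv_apply_self] using TreeAut.prefix_apply g⁻¹ h

theorem eq_of_prefix_of_prefix {p q r : List X} (h : p.length = q.length) (hp : p <+: r)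
    (hq : q <+: r) : p = q := by
  rw [List.prefix_iff_eq_take] at hp hq
  rw [hp, hq, h]

theorem TreeAut.state_pow (g : TreeAut X) {p : List X} (hp : g p = p) (k : ℕ) :
    (g ^ k) p = p ∧ (g ^ k).state p = g.state p ^ k := by
  induction k with
  | zero =>
    refine ⟨rfl, RelIso.ext fun q => ?_⟩
    have h := TreeAut.apply_append_state (g ^ 0) p q
    simp only [pow_zero] at h ⊢
    exact (List.append_cancel_left h).symm
  | succ k ih =>
    have hk : (g ^ (k + 1)) p = p := by
      rw [pow_succ, TreeAut.mul_apply, hp, ih.1]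
    refine ⟨hk, RelIso.ext fun q => ?_⟩
    have h := TreeAut.apply_append_state (g ^ (k + 1)) p q
    rw [hk, pow_succ, TreeAut.mul_apply, g.apply_append_state, hp, TreeAut.apply_append_state,
      ih.1, ih.2] at h
    rw [pow_succ, pow_succ, TreeAut.mul_apply]
    exact (List.append_cancel_left h).symm

theorem translate_injective (p : List X) : Function.Injective (translate p) := by
  intro g h hgh
  ext1 q
  have := congrArg (fun f : TreeAut X => f (p ++ q)) hgh
  simpa only [translate_apply, translateFun_append, List.append_cancel_left_eq] using this

/-- An automorphism of the tree is determined by its values on the words of length at least `n`. -/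
theorem TreeAut.ext_of_level {g h : TreeAut X} (n : ℕ)
    (H : ∀ p : List X, p.length = n → ∀ q, g (p ++ q) = h (p ++ q)) : g = h := by
  ext1 q
  rcases isEmpty_or_nonempty X with hX | ⟨⟨x⟩⟩
  · exact Subsingleton.elim _ _
  -- a shorter word is a prefix of one of length at least `n`
  · have hlen : n ≤ (q ++ List.replicate n x).length := by simp
    have h1 := H ((q ++ List.replicate n x).take n) (by simp)
      ((q ++ List.replicate n x).drop n)
    rw [List.take_append_drop, g.apply_append, h.apply_append] at h1
    exact (List.append_inj h1 (by rw [g.length_apply, h.length_apply])).1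

/-- An automorphism that fixes the level `n` is the product of the automorphisms `p*(g@p)`
over the vertices `p` of that level. -/
theorem TreeAut.mem_of_translate_state_mem [Finite X] (H : Subgroup (TreeAut X)) (g : TreeAut X)
    (n : ℕ) (hg : ∀ p : List X, p.length = n → g p = p)
    (hH : ∀ p : List X, p.length = n → translate p (g.state p) ∈ H) : g ∈ H := by
  classical
  -- the factors are multiplied in one at a time
  have key : ∀ s : Finset (List X), (∀ p ∈ s, p.length = n) → ∃ h ∈ H, ∀ p : List X,
      p.length = n → ∀ q, h (p ++ q) = if p ∈ s then g (p ++ q) else p ++ q := by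
    intro s
    induction s using Finset.induction_on with
    | empty => exact fun _ => ⟨1, H.one_mem, fun p _ q => by simp⟩
    | insert a s ha ih =>
      intro hs
      obtain ⟨h, hh, hval⟩ := ih fun p hp => hs p (Finset.mem_insert_of_mem hp)
      have han := hs a (Finset.mem_insert_self a s)
      refine ⟨translate a (g.state a) * h, H.mul_mem (hH a han) hh, fun p hp q => ?_⟩
      rw [TreeAut.mul_apply, hval p hp]
      by_cases hpa : p = a
      · subst hpa
        rw [if_neg ha, if_pos (Finset.mem_insert_self _ _), translate_apply, translateFun_append,
          g.apply_append_state, hg p hp]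
      · have hnot : ∀ r : List X, ¬ a <+: p ++ r := fun r har =>
          hpa (eq_of_prefix_of_prefix (hp.trans han.symm) (List.prefix_append _ _) har)
        simp only [Finset.mem_insert, hpa, false_or]
        split_ifs
        · rw [g.apply_append_state, hg p hp, translate_apply, translateFun_of_not _ (hnot _)]
        · rw [translate_apply, translateFun_of_not _ (hnot _)]
  have hfin : {p : List X | p.length = n}.Finite := List.finite_length_eq X n
  obtain ⟨h, hh, hval⟩ := key hfin.toFinset (by simp)
  have : g = h := TreeAut.ext_of_level n fun p hp q => by
    rw [hval p hp, if_pos (by simpa using hp)]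
  rwa [this]

/-- A non-trivial group of tree automorphisms that contains all its translates is infinite: for a
finite group `K`, all the `x*K` with `x` a letter would equal `K`, so that `K` would fix every
word. -/
theorem infinite_of_translate_le {K : Subgroup (TreeAut X)} (hK : K ≠ ⊥)
    (h : ∀ p : List X, K.map (translate p) ≤ K) : (K : Set (TreeAut X)).Infinite := by
  intro hfin
  refine hK ((Subgroup.eq_bot_iff_forall K).2 fun k hk => RelIso.ext fun q => ?_)
  have heq : ∀ x : X, ∃ k' : TreeAut X, translate [x] k' = k := by
    intro x
    have hsub : translate [x] '' (K : Set (TreeAut X)) ⊆ K := h [x]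
    have := Set.eq_of_subset_of_ncard_le hsub
      (Set.ncard_image_of_injective _ (translate_injective [x])).ge hfin
    obtain ⟨k', -, hk'⟩ := this.ge hk
    exact ⟨k', hk'⟩
  cases q with
  | nil => exact k.apply_nil
  | cons y r =>
    by_cases hx : ∃ x, x ≠ y
    · obtain ⟨x, hx⟩ := hx
      obtain ⟨k', rfl⟩ := heq x
      rw [translate_apply, translateFun_of_not _ (by simpa using hx)]
      rfl
    · push Not at hx
      have : Subsingleton X := ⟨fun a b => (hx a).trans (hx b).symm⟩
      have hlen := k.length_apply (y :: r)
      exact List.ext_getElem hlen fun i _ _ => Subsingleton.elim _ _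

end TreeLemmas

/-! ### Rigid stabilizers -/

section Rigid

variable {Γ : Type u} [Group Γ] {X : Type v}

/-- The rigid stabilizer of the vertex `p`: the elements of `Γ` that move no vertex outside of the
subtree rooted at `p`. -/
def rist (ρ : Γ →* TreeAut X) (p : List X) : Subgroup Γ where
  carrier := {g | ∀ q : List X, ¬ p <+: q → ρ g q = q}
  one_mem' q _ := by rw [map_one]; rfl
  mul_mem' {g h} hg hh q hq := by rw [map_mul, TreeAut.mul_apply, hh q hq, hg q hq]
  inv_mem' {g} hg q hq := by
    rw [map_inv]
    conv_lhs => rw [← hg q hq]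
    exact TreeAut.inv_apply_self _ _

/-- The rigid stabilizer of the level `n`: the subgroup generated by the rigid stabilizers of the
vertices of that level. -/
def ristLevel (ρ : Γ →* TreeAut X) (n : ℕ) : Subgroup Γ :=
  ⨆ p : {p : List X // p.length = n}, rist ρ p.1

variable {ρ : Γ →* TreeAut X}

theorem mem_rist {p : List X} {g : Γ} : g ∈ rist ρ p ↔ ∀ q : List X, ¬ p <+: q → ρ g q = q :=
  Iff.rfl

theorem conj_mem_rist {p : List X} {h : Γ} (hh : h ∈ rist ρ p) (g : Γ) :
    g * h * g⁻¹ ∈ rist ρ (ρ g p) := by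
  intro q hq
  rw [map_mul, map_mul, map_inv, TreeAut.mul_apply, TreeAut.mul_apply, mem_rist.1 hh,
    TreeAut.apply_inv_self]
  rwa [← (ρ g).prefix_apply_iff, TreeAut.apply_inv_self]

theorem rist_anti {p q : List X} (h : p <+: q) : rist ρ q ≤ rist ρ p :=
  fun _ hg r hr => hg r fun hqr => hr (h.trans hqr)

theorem rist_inf_eq_one (hρ : Function.Injective ρ) {p q : List X} (hlen : p.length = q.length)
    (hpq : p ≠ q) {g : Γ} (hp : g ∈ rist ρ p) (hq : g ∈ rist ρ q) : g = 1 := by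
  refine hρ (RelIso.ext fun r => ?_)
  rw [map_one]
  by_cases h : p <+: r
  · exact hq r fun h' => hpq (eq_of_prefix_of_prefix hlen h h')
  · exact hp r h

theorem rist_commute (hρ : Function.Injective ρ) {p q : List X} (hlen : p.length = q.length)
    (hpq : p ≠ q) {g h : Γ} (hg : g ∈ rist ρ p) (hh : h ∈ rist ρ q) : Commute g h := by
  have hd : Equiv.Perm.Disjoint (ρ g).toEquiv (ρ h).toEquiv := fun r => by
    by_cases hr : p <+: r
    · exact Or.inr (hh r fun h' => hpq (eq_of_prefix_of_prefix hlen hr h'))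
    · exact Or.inl (hg r hr)
  refine hρ (RelIso.ext fun r => ?_)
  rw [map_mul, map_mul]
  exact congrArg (fun f : Equiv.Perm (List X) => f r) hd.commute.eq

/-- If `h ∈ H` moves the vertex `p` and `a`, `b` belong to the rigid stabilizer of `p`, then
`⁅a, b⁆ = ⁅⁅a, h⁆, b⁆`, because the conjugate of `a` by `h` commutes with `a` and `b`. Hence
`⁅a, b⁆` lies in `H` as soon as `a` and `b` normalize `H`. -/
theorem commutator_mem_of_moves (hρ : Function.Injective ρ) {H : Subgroup Γ} {p : List X}
    {a b h : Γ} (ha : a ∈ rist ρ p) (hb : b ∈ rist ρ p) (hh : h ∈ H) (hp : ρ h p ≠ p)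
    (haH : ∀ x ∈ H, a * x * a⁻¹ ∈ H) (hbH : ∀ x ∈ H, b * x * b⁻¹ ∈ H) :
    a * b * a⁻¹ * b⁻¹ ∈ H := by
  have hc : Commute b (h * a⁻¹ * h⁻¹) :=
    rist_commute hρ ((ρ h).length_apply p).symm hp.symm hb
      (conj_mem_rist ((rist ρ p).inv_mem ha) h)
  have hx : a * h * a⁻¹ * h⁻¹ ∈ H := H.mul_mem (haH h hh) (H.inv_mem hh)
  have hy := H.mul_mem hx (hbH _ (H.inv_mem hx))
  convert hy using 1
  have hc' : h * a⁻¹ * h⁻¹ * b * (h * a⁻¹ * h⁻¹)⁻¹ = b := by rw [← hc.eq, mul_inv_cancel_right]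
  calc a * b * a⁻¹ * b⁻¹
      = a * (h * a⁻¹ * h⁻¹ * b * (h * a⁻¹ * h⁻¹)⁻¹) * a⁻¹ * b⁻¹ := by rw [hc']
    _ = _ := by group

theorem conj_mem_rist_of_mem_levelStab {n : ℕ} {p : List X} (hp : p.length = n) {g : Γ}
    (hg : g ∈ levelStab ρ n) : ∀ x ∈ rist ρ p, g * x * g⁻¹ ∈ rist ρ p := by
  intro x hx
  have := conj_mem_rist hx g
  rwa [(mem_levelStab ρ n g).1 hg p hp] at this

theorem rist_le_ristLevel {n : ℕ} {p : List X} (hp : p.length = n) :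
    rist ρ p ≤ ristLevel ρ n :=
  le_iSup (fun p : {p : List X // p.length = n} => rist ρ p.1) ⟨p, hp⟩

instance ristLevel_normal (ρ : Γ →* TreeAut X) (n : ℕ) : (ristLevel ρ n).Normal := by
  refine ⟨fun x hx g => ?_⟩
  have hle : ristLevel ρ n ≤ (ristLevel ρ n).comap (MulAut.conj g).toMonoidHom :=
    iSup_le fun p y hy => rist_le_ristLevel (by rw [(ρ g).length_apply, p.2]) (conj_mem_rist hy g)
  exact hle hx

end Rigid

/-! ### Regular branch representations -/

section RegularBranch

variable {Γ : Type u} [Group Γ] {X : Type v} {ρ : Γ →* TreeAut X}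

theorem map_translate_le_map_rist {K : Subgroup (TreeAut X)} (hK : K ≤ ρ.range)
    (h : ∀ p : List X, K.map (translate p) ≤ K) (p : List X) :
    K.map (translate p) ≤ (rist ρ p).map ρ := by
  intro k hk
  obtain ⟨a, rfl⟩ := hK (h p hk)
  refine ⟨a, fun q hq => ?_, rfl⟩
  obtain ⟨k', -, hk'⟩ := hk
  rw [← hk', translate_apply, translateFun_of_not _ hq]

/-- Under a faithful representation, `X^n*K` corresponds to a subgroup of `ristLevel ρ n`. -/
theorem comap_levelTranslate_le (hρ : Function.Injective ρ) {K : Subgroup (TreeAut X)}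
    (hK : K ≤ ρ.range) (h : ∀ p : List X, K.map (translate p) ≤ K) (n : ℕ) :
    (levelTranslate n K).comap ρ ≤ ristLevel ρ n := by
  have hle : levelTranslate n K ≤ (ristLevel ρ n).map ρ :=
    iSup_le fun p => (map_translate_le_map_rist hK h p.1).trans
      (Subgroup.map_mono (rist_le_ristLevel p.2))
  exact (Subgroup.comap_mono hle).trans (Subgroup.comap_map_eq_self_of_injective hρ _).le

theorem finiteIndex_comap_levelTranslate {K : Subgroup (TreeAut X)} (n : ℕ)
    (h : (levelTranslate n K).IsFiniteRelIndex ρ.range) :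
    ((levelTranslate n K).comap ρ).FiniteIndex :=
  ⟨by rw [Subgroup.index_comap]; exact h.relIndex_ne_zero⟩

namespace IsRegularBranchRep

theorem ristLevel_finiteIndex (hρ : IsRegularBranchRep ρ) (n : ℕ) :
    (ristLevel ρ n).FiniteIndex := by
  obtain ⟨K, hK, -, hKp, hfin⟩ := hρ.regularBranch
  have := finiteIndex_comap_levelTranslate n (hfin n)
  exact Subgroup.finiteIndex_of_le (comap_levelTranslate_le hρ.faithful hK hKp n)

/-- Rigid stabilizers of vertices are infinite, as they contain a copy of the infinite branching
subgroup; so they meet every subgroup of finite index non-trivially. -/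
theorem exists_mem_rist_ne_one (hρ : IsRegularBranchRep ρ) (D : Subgroup Γ) [D.FiniteIndex]
    (p : List X) : ∃ g ∈ rist ρ p, g ∈ D ∧ g ≠ 1 := by
  by_contra! hcon
  obtain ⟨K, hK, hK1, hKp, -⟩ := hρ.regularBranch
  have hinj : Function.Injective fun g : rist ρ p => (g.1 : Γ ⧸ D) := by
    intro g h hgh
    have hmem : g.1⁻¹ * h.1 ∈ D := QuotientGroup.eq.1 hgh
    exact Subtype.ext (inv_mul_eq_one.1
      (hcon _ ((rist ρ p).mul_mem ((rist ρ p).inv_mem g.2) h.2) hmem))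
  have hfin : (rist ρ p : Set Γ).Finite := Finite.of_injective _ hinj
  have himage : (translate p '' (K : Set (TreeAut X))).Finite :=
    (hfin.image ρ).subset (map_translate_le_map_rist hK hKp p)
  exact infinite_of_translate_le hK1 hKp (himage.of_finite_image (translate_injective p).injOn)

/-- Rigid stabilizers of vertices are not virtually abelian. -/
theorem exists_mem_rist_not_commute (hρ : IsRegularBranchRep ρ) (D : Subgroup Γ) [D.FiniteIndex]
    (p : List X) :
    ∃ a ∈ rist ρ p, ∃ b ∈ rist ρ p, a ∈ D ∧ b ∈ D ∧ a * b * a⁻¹ * b⁻¹ ≠ 1 := by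
  obtain ⟨a, ha, haD, ha1⟩ := hρ.exists_mem_rist_ne_one D p
  obtain ⟨q, hq⟩ : ∃ q, ρ a q ≠ q := by
    by_contra! h
    exact ha1 (hρ.faithful (RelIso.ext fun q => by rw [h q, map_one]; rfl))
  have hpq : p <+: q := by
    by_contra h
    exact hq (ha q h)
  obtain ⟨b, hb, hbD, hb1⟩ := hρ.exists_mem_rist_ne_one D q
  refine ⟨a, ha, b, rist_anti hpq hb, haD, hbD, fun h => hb1 ?_⟩
  -- if `a` and `b` commute, then `b` is supported both below `q` and below its image under `a`
  have h1 : a * b * a⁻¹ = b := mul_inv_eq_one.1 h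
  have h2 := conj_mem_rist hb a
  rw [h1] at h2
  exact rist_inf_eq_one hρ.faithful ((ρ a).length_apply q).symm hq.symm hb h2

/-- The level stabilizers of one regular branch representation contain those of any other one.
If `h ∈ rist ρ v` moves a vertex `w` of the other tree and `g` fixes `w`, then the conjugate of `h`
by `g` moves `w` too, and it belongs to the rigid stabilizer of the image `v'` of `v` under `g`. So
both `rist ρ v` and `rist ρ v'` contain the commutators of `rist σ w ∩ levelStab ρ n`, which are
not all trivial, whence `v = v'`. -/
theorem exists_levelStab_le {Y : Type w} [Finite X] {σ : Γ →* TreeAut Y}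
    (hρ : IsRegularBranchRep ρ) (hσ : IsRegularBranchRep σ) (n : ℕ) :
    ∃ m, levelStab σ m ≤ levelStab ρ n := by
  rcases isEmpty_or_nonempty X with hX | ⟨⟨x⟩⟩
  · exact ⟨0, fun g _ => (mem_levelStab ρ n g).2 fun _ _ => Subsingleton.elim _ _⟩
  have hv₀ : (List.replicate n x).length = n := List.length_replicate
  generalize List.replicate n x = v₀ at hv₀
  obtain ⟨h₀, hh₀, -, hh₀1⟩ := hρ.exists_mem_rist_ne_one ⊤ v₀
  obtain ⟨w₀, hw₀⟩ : ∃ q, σ h₀ q ≠ q := by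
    by_contra! h
    exact hh₀1 (hσ.faithful (RelIso.ext fun q => by rw [h q, map_one]; rfl))
  refine ⟨w₀.length, fun g hg => (mem_levelStab ρ n g).2 fun v hv => ?_⟩
  have conj_moves : ∀ (c h : Γ) (w : List Y), σ h w ≠ w →
      σ (c * h * c⁻¹) (σ c w) ≠ σ c w := by
    intro c h w hw hc
    rw [map_mul, map_mul, map_inv, TreeAut.mul_apply, TreeAut.mul_apply,
      TreeAut.inv_apply_self] at hc
    exact hw ((σ c).injective hc)
  obtain ⟨_, ⟨c, rfl⟩, hc⟩ := hρ.levelTransitive v₀ v (hv₀.trans hv.symm)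
  have hh := conj_mem_rist hh₀ c
  rw [hc] at hh
  have hw := conj_moves c h₀ w₀ hw₀
  have hgw : σ g (σ c w₀) = σ c w₀ :=
    (mem_levelStab σ _ g).1 hg _ ((σ c).length_apply w₀)
  generalize c * h₀ * c⁻¹ = h at hh hw
  generalize σ c w₀ = w at hw hgw
  have hw' := conj_moves g h w hw
  rw [hgw] at hw'
  have hh' := conj_mem_rist hh g
  have hv' : (ρ g v).length = n := by rw [(ρ g).length_apply, hv]
  obtain ⟨a, ha, b, hb, haD, hbD, hab⟩ := hσ.exists_mem_rist_not_commute (levelStab ρ n) w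
  by_contra hne
  refine hab (rist_inf_eq_one hρ.faithful (hv'.trans hv.symm) hne ?_ ?_)
  · exact commutator_mem_of_moves hσ.faithful ha hb hh' hw'
      (conj_mem_rist_of_mem_levelStab hv' haD) (conj_mem_rist_of_mem_levelStab hv' hbD)
  · exact commutator_mem_of_moves hσ.faithful ha hb hh hw
      (conj_mem_rist_of_mem_levelStab hv haD) (conj_mem_rist_of_mem_levelStab hv hbD)

/-- A finite-index normal subgroup contains the derived subgroup of some rigid level
stabilizer. All vertices of the level of a vertex that it moves are moved by some element of
it. -/
theorem exists_commutator_ristLevel_mem (hρ : IsRegularBranchRep ρ) (N : Subgroup Γ) [N.Normal]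
    [N.FiniteIndex] :
    ∃ n, ∀ a ∈ ristLevel ρ n, ∀ b ∈ ristLevel ρ n, (a : Γ ⧸ N) * b = b * a := by
  obtain ⟨h₀, -, hh₀, hh₀1⟩ := hρ.exists_mem_rist_ne_one N []
  obtain ⟨p₀, hp₀⟩ : ∃ q, ρ h₀ q ≠ q := by
    by_contra! h
    exact hh₀1 (hρ.faithful (RelIso.ext fun q => by rw [h q, map_one]; rfl))
  refine ⟨p₀.length, ?_⟩
  have moves : ∀ p : List X, p.length = p₀.length → ∃ h ∈ N, ρ h p ≠ p := by
    intro p hp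
    obtain ⟨_, ⟨c, rfl⟩, hc⟩ := hρ.levelTransitive p₀ p hp.symm
    refine ⟨c * h₀ * c⁻¹, Subgroup.Normal.conj_mem inferInstance _ hh₀ c, fun h => hp₀ ?_⟩
    rw [← hc, map_mul, map_mul, map_inv, TreeAut.mul_apply, TreeAut.mul_apply,
      TreeAut.inv_apply_self] at h
    exact (ρ c).injective h
  -- the rigid stabilizers generating `ristLevel ρ n` commute elementwise modulo `N`
  have hgen : ∀ p q : List X, p.length = p₀.length → q.length = p₀.length →
      ∀ a ∈ rist ρ p, ∀ b ∈ rist ρ q, (a : Γ ⧸ N) * b = b * a := by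
    intro p q hp hq a ha b hb
    by_cases hpq : p = q
    · subst hpq
      obtain ⟨h, hh, hhp⟩ := moves p hp
      have := commutator_mem_of_moves hρ.faithful ha hb hh hhp
        (fun x hx => Subgroup.Normal.conj_mem inferInstance x hx a)
        (fun x hx => Subgroup.Normal.conj_mem inferInstance x hx b)
      rw [← QuotientGroup.eq_one_iff] at this
      simp only [QuotientGroup.mk_mul, QuotientGroup.mk_inv] at this
      exact mul_inv_eq_iff_eq_mul.1 (mul_inv_eq_one.1 this)
    · have := (rist_commute hρ.faithful (hp.trans hq.symm) hpq ha hb).eq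
      rw [← QuotientGroup.mk_mul, this, QuotientGroup.mk_mul]
  have hle : ∀ q : List X, q.length = p₀.length → ∀ b ∈ rist ρ q, ∀ a ∈ ristLevel ρ p₀.length,
      (a : Γ ⧸ N) * b = b * a := by
    intro q hq b hb a ha
    have : ristLevel ρ p₀.length ≤
        (Subgroup.centralizer {(b : Γ ⧸ N)}).comap (QuotientGroup.mk' N) :=
      iSup_le fun p a ha => Subgroup.mem_centralizer_singleton_iff.2 (hgen p.1 q p.2 hq a ha b hb)
    exact Subgroup.mem_centralizer_singleton_iff.1 (this ha)
  intro a ha b hb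
  have : ristLevel ρ p₀.length ≤
      (Subgroup.centralizer {(a : Γ ⧸ N)}).comap (QuotientGroup.mk' N) :=
    iSup_le fun q b hb => Subgroup.mem_centralizer_singleton_iff.2 (hle q.1 q.2 b hb a ha).symm
  exact (Subgroup.mem_centralizer_singleton_iff.1 (this hb)).symm

/-- Some fixed power maps every level stabilizer into the rigid stabilizer of the same level. By
self-similarity the states of an element of the level stabilizer are in the image of `ρ`, and their
powers with exponent the index of the normal core of the branching subgroup `K` are in `K`. -/
theorem exists_pow_mem_ristLevel [Finite X] (hρ : IsRegularBranchRep ρ) :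
    ∃ e, 0 < e ∧ ∀ n, ∀ g ∈ levelStab ρ n, g ^ e ∈ ristLevel ρ n := by
  obtain ⟨K, hK, -, hKp, hfin⟩ := hρ.regularBranch
  have hfin0 := finiteIndex_comap_levelTranslate 0 (hfin 0)
  have hKfin : (K.comap ρ).FiniteIndex :=
    Subgroup.finiteIndex_of_le (Subgroup.comap_mono (iSup_le fun p => hKp p.1) :
      (levelTranslate 0 K).comap ρ ≤ _)
  refine ⟨(K.comap ρ).normalCore.index, Nat.pos_of_ne_zero Subgroup.FiniteIndex.index_ne_zero,
    fun n g hg => comap_levelTranslate_le hρ.faithful hK hKp n ?_⟩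
  set e := (K.comap ρ).normalCore.index
  rw [mem_levelStab] at hg
  rw [Subgroup.mem_comap, map_pow]
  refine TreeAut.mem_of_translate_state_mem _ _ n (fun p hp => ((ρ g).state_pow (hg p hp) e).1)
    fun p hp => ?_
  rw [((ρ g).state_pow (hg p hp) e).2]
  obtain ⟨s, hs⟩ := hρ.selfSimilar (ρ g) ⟨g, rfl⟩ p
  have hse : s ^ e ∈ K.comap ρ :=
    Subgroup.normalCore_le _ (Subgroup.pow_index_mem (K.comap ρ).normalCore s)
  rw [Subgroup.mem_comap, map_pow, hs] at hse
  exact le_iSup (fun p : {p : List X // p.length = n} => K.map (translate p.1)) ⟨p, hp⟩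
    ⟨_, hse, rfl⟩

end IsRegularBranchRep

end RegularBranch

/-! ### Congruence kernel and branch kernel -/

section Completion

variable {Γ : Type u} [Group Γ] {X : Type v} {ρ : Γ →* TreeAut X}

theorem toQuotient_of_le {M N : FiniteIndexNormalSubgroup Γ} (h : M.toSubgroup ≤ N.toSubgroup)
    {x : ProfiniteCompletion Γ} {a : Γ} (hx : toQuotient M x = a) : toQuotient N x = a := by
  rw [← map_toQuotient h, hx]
  rfl

theorem profiniteCompletion_ext {x y : ProfiniteCompletion Γ}
    (h : ∀ N : FiniteIndexNormalSubgroup Γ, toQuotient N x = toQuotient N y) : x = y :=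
  Subtype.ext (funext h)

theorem continuous_toQuotient (N : FiniteIndexNormalSubgroup Γ) :
    Continuous fun x : ProfiniteCompletion Γ =>
      (x.1 N : (ProfiniteGrp.ProfiniteCompletion.diagram (GrpCat.of Γ)).obj N) :=
  (continuous_apply N).comp continuous_subtype_val

theorem isClosed_setOf_toQuotient_eq_one (N : FiniteIndexNormalSubgroup Γ) :
    IsClosed {x : ProfiniteCompletion Γ | toQuotient N x = 1} :=
  (isClosed_singleton (x :=
    (1 : (ProfiniteGrp.ProfiniteCompletion.diagram (GrpCat.of Γ)).obj N))).preimage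
    (continuous_toQuotient N)

theorem mem_congruenceKernel [Finite X] {x : ProfiniteCompletion Γ} :
    x ∈ congruenceKernel ρ ↔
      ∀ n, toQuotient (FiniteIndexNormalSubgroup.ofSubgroup (levelStab ρ n)) x = 1 := by
  rw [congruenceKernel, MonoidHom.mem_ker, Subtype.ext_iff, funext_iff]
  rfl

theorem congruenceKernel_le_of_levelStab_le [Finite X] {Y : Type w} [Finite Y]
    {σ : Γ →* TreeAut Y} (h : ∀ n, ∃ m, levelStab σ m ≤ levelStab ρ n) :
    congruenceKernel σ ≤ congruenceKernel ρ := by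
  intro x hx
  rw [mem_congruenceKernel] at hx ⊢
  intro n
  obtain ⟨m, hm⟩ := h n
  exact toQuotient_of_le (N := FiniteIndexNormalSubgroup.ofSubgroup (levelStab ρ n)) hm
    (a := 1) (hx m)

theorem IsRegularBranchRep.congruenceKernel_eq [Finite X] {Y : Type w} [Finite Y]
    {σ : Γ →* TreeAut Y} (hρ : IsRegularBranchRep ρ) (hσ : IsRegularBranchRep σ) :
    congruenceKernel σ = congruenceKernel ρ :=
  le_antisymm (congruenceKernel_le_of_levelStab_le (hρ.exists_levelStab_le hσ))
    (congruenceKernel_le_of_levelStab_le (hσ.exists_levelStab_le hρ))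

/-- The rigid stabilizer of the level `n` as a finite-index normal subgroup. -/
def IsRegularBranchRep.ristQuotient (hρ : IsRegularBranchRep ρ) (n : ℕ) :
    FiniteIndexNormalSubgroup Γ :=
  have := hρ.ristLevel_finiteIndex n
  FiniteIndexNormalSubgroup.ofSubgroup (ristLevel ρ n)

/-- The branch kernel, that is the kernel of the natural map from the profinite completion to the
completion with respect to the rigid level stabilizers. -/
def IsRegularBranchRep.branchKernel (hρ : IsRegularBranchRep ρ) :
    Subgroup (ProfiniteCompletion Γ) :=
  ⨅ n, (toQuotient (hρ.ristQuotient n)).ker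

namespace IsRegularBranchRep

theorem mem_branchKernel (hρ : IsRegularBranchRep ρ) {x : ProfiniteCompletion Γ} :
    x ∈ hρ.branchKernel ↔ ∀ n, toQuotient (hρ.ristQuotient n) x = 1 := by
  simp only [branchKernel, Subgroup.mem_iInf, MonoidHom.mem_ker]

theorem branchKernel_normal (hρ : IsRegularBranchRep ρ) : hρ.branchKernel.Normal :=
  Subgroup.normal_iInf_normal fun _ => MonoidHom.normal_ker _

theorem isClosed_branchKernel (hρ : IsRegularBranchRep ρ) :
    IsClosed (hρ.branchKernel : Set (ProfiniteCompletion Γ)) := by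
  have : (hρ.branchKernel : Set (ProfiniteCompletion Γ)) =
      ⋂ n, {x | toQuotient (hρ.ristQuotient n) x = 1} := by
    ext x
    simp only [SetLike.mem_coe, mem_branchKernel, Set.mem_iInter, Set.mem_ofPred_eq]
  rw [this]
  exact isClosed_iInter fun n => isClosed_setOf_toQuotient_eq_one _

/-- The branch kernel is abelian: its image in a finite quotient `Γ ⧸ N` is represented by elements
of any given rigid level stabilizer, and those of a suitable level commute modulo `N`. -/
theorem branchKernel_commute (hρ : IsRegularBranchRep ρ) {x y : ProfiniteCompletion Γ}
    (hx : x ∈ hρ.branchKernel) (hy : y ∈ hρ.branchKernel) : x * y = y * x := by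
  refine profiniteCompletion_ext fun N => ?_
  obtain ⟨n, hn⟩ := hρ.exists_commutator_ristLevel_mem N.toSubgroup
  have rep : ∀ z ∈ hρ.branchKernel, ∃ a ∈ ristLevel ρ n, toQuotient N z = a := by
    intro z hz
    obtain ⟨a, ha⟩ := QuotientGroup.mk_surjective (toQuotient (N ⊓ hρ.ristQuotient n) z)
    refine ⟨a, ?_, toQuotient_of_le inf_le_left ha.symm⟩
    have h1 := toQuotient_of_le (N := hρ.ristQuotient n) inf_le_right ha.symm
    rw [hρ.mem_branchKernel.1 hz n] at h1
    exact (QuotientGroup.eq_one_iff a).1 h1.symm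
  obtain ⟨a, ha, hxa⟩ := rep x hx
  obtain ⟨b, hb, hyb⟩ := rep y hy
  rw [map_mul, map_mul, hxa, hyb]
  exact hn a ha b hb

theorem exists_pow_mem_branchKernel [Finite X] (hρ : IsRegularBranchRep ρ) :
    ∃ e, 0 < e ∧ ∀ x ∈ congruenceKernel ρ, x ^ e ∈ hρ.branchKernel := by
  obtain ⟨e, he, hpow⟩ := hρ.exists_pow_mem_ristLevel
  refine ⟨e, he, fun x hx => hρ.mem_branchKernel.2 fun n => ?_⟩
  obtain ⟨a, ha⟩ := QuotientGroup.mk_surjective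
    (toQuotient (FiniteIndexNormalSubgroup.ofSubgroup (levelStab ρ n) ⊓ hρ.ristQuotient n) x)
  have h1 := toQuotient_of_le (N := FiniteIndexNormalSubgroup.ofSubgroup (levelStab ρ n))
    inf_le_left ha.symm
  rw [mem_congruenceKernel.1 hx n] at h1
  have h2 := toQuotient_of_le (N := hρ.ristQuotient n) inf_le_right ha.symm
  rw [map_pow, h2, ← QuotientGroup.mk_pow]
  exact (QuotientGroup.eq_one_iff _).2 (hpow n a ((QuotientGroup.eq_one_iff a).1 h1.symm))

theorem abelianByFiniteExponent [Finite X] (hρ : IsRegularBranchRep ρ) :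
    AbelianByFiniteExponent (congruenceKernel ρ) := by
  have := hρ.branchKernel_normal
  refine ⟨hρ.branchKernel.subgroupOf (congruenceKernel ρ), inferInstance,
    hρ.isClosed_branchKernel.preimage continuous_subtype_val,
    fun a ha b hb => Subtype.ext (hρ.branchKernel_commute ha hb), ?_⟩
  obtain ⟨e, he, hpow⟩ := hρ.exists_pow_mem_branchKernel
  refine ⟨e, he, fun x => ?_⟩
  obtain ⟨y, rfl⟩ := QuotientGroup.mk_surjective x
  rw [← QuotientGroup.mk_pow]
  exact (QuotientGroup.eq_one_iff _).2 (hpow y.1 y.2)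

end IsRegularBranchRep

end Completion

end CongruenceKernel

theorem theoremC {Γ : Type u} [Group Γ] {X : Type v} [Finite X]
    (ρ : Γ →* CongruenceKernel.TreeAut X) (hρ : CongruenceKernel.IsRegularBranchRep ρ) :
    (∀ (Y : Type w) [Finite Y] (σ : Γ →* CongruenceKernel.TreeAut Y),
      CongruenceKernel.IsRegularBranchRep σ →
        CongruenceKernel.congruenceKernel σ = CongruenceKernel.congruenceKernel ρ) ∧
    CongruenceKernel.AbelianByFiniteExponent (CongruenceKernel.congruenceKernel ρ) :=
  ⟨fun _ _ _ hσ => hρ.congruenceKernel_eq hσ, hρ.abelianByFiniteExponent⟩
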